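/- Let $\mathcal H_A=\mathcal H_B=\mathbb C^2$ and $\mathcal H=\mathcal H_A\otimes\mathcal H_B$ (two qubits). A state is a positive semidefinite operator of trace one; a state on $\mathcal H$ is separable if it is a finite convex combination of product states $\sigma\otimes\tau$, with $\sigma$, $\tau$ states on $\mathcal H_A$, $\mathcal H_B$, and entangled otherwise. Let $H$ be a self-adjoint operator on $\mathcal H$ and let $A_1,\dots,A_N$ be linear operators on $\mathcal H$ such that some $A_i$ is not a complex multiple of the identity and $$\sum_{i=1}^N\left(A_iA_i^*-A_i^*A_i\right)=0 .$$ Let $(\Lambda_t)_{t\ge 0}$ be the dynamics described by the Lindblad equation $$\frac{d\rho(t)}{dt}=-i[H,\rho(t)]+\sum_{i=1}^{N}\left(A_i\rho(t)A_i^*-\tfrac12\left(A_i^*A_i\,\rho(t)+\rho(t)\,A_i^*A_i\right)\right),$$ that is, a family of linear maps on the operators on $\mathcal H$ such that, for every initial state $\rho_0$, $\rho(t)=\Lambda_t(\rho_0)$ satisfies this equation for all $t\ge 0$ (with a one-sided derivative at $t=0$) and $\rho(0)=\rho_0$. Then every $\Lambda_t$, $t\ge 0$, is unital, i.e. $\Lambda_t(\mathbb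 1)=\mathbb 1$, and the dynamics exhibits finite-time disentanglement: there exist an entangled state $\rho_{\mathrm{ent}}$ and an interval $(a,b)$ with $0<a<b\le\infty$ such that $\Lambda_t(\rho_{\mathrm{ent}})$ is separable for all $t\in(a,b)$. -/

import Mathlib

open scoped Matrix Kronecker ComplexOrder

namespace QDyn

variable {m n : Type*} [Fintype m] [Fintype n]

/-- Density operators (quantum states): positive semidefinite matrices of trace one. -/
def IsState (ρ : Matrix n n ℂ) : Prop :=
  ρ.PosSemidef ∧ ρ.trace = 1

/-- Product states `σ ⊗ τ` of a bipartite system. -/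
def productStates (m n : Type*) [Fintype m] [Fintype n] : Set (Matrix (m × n) (m × n) ℂ) :=
  {ρ | ∃ (σ : Matrix m m ℂ) (τ : Matrix n n ℂ), IsState σ ∧ IsState τ ∧ ρ = σ ⊗ₖ τ}

/-- Separable states: (finite) convex combinations of product states. -/
def IsSeparable (ρ : Matrix (m × n) (m × n) ℂ) : Prop :=
  ρ ∈ convexHull ℝ (productStates m n)

/-- Entangled states: states that are not separable. -/
def IsEntangled (ρ : Matrix (m × n) (m × n) ℂ) : Prop :=
  IsState ρ ∧ ¬ IsSeparable ρ

/-- Finite-time disentanglement of a family `Λ t` (only the times `t ≥ 0` matter): some entangled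
state is mapped to separable states during a whole interval `(a, b)` with `0 < a < b ≤ ∞`. -/
def HasFTD (Λ : ℝ → Matrix (m × n) (m × n) ℂ →ₗ[ℂ] Matrix (m × n) (m × n) ℂ) : Prop :=
  ∃ ρ, IsEntangled ρ ∧ ∃ (a : ℝ) (b : EReal), 0 < a ∧ (a : EReal) < b ∧
    ∀ t : ℝ, a < t → (t : EReal) < b → IsSeparable (Λ t ρ)

/-- The right-hand side of the Lindblad equation,
`-i[H, ρ] + ∑ᵢ (Aᵢ ρ Aᵢ* - ½ {Aᵢ* Aᵢ, ρ})`. -/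
noncomputable def lindbladian {N : ℕ} (H : Matrix n n ℂ) (A : Fin N → Matrix n n ℂ)
    (ρ : Matrix n n ℂ) : Matrix n n ℂ :=
  -(Complex.I • (H * ρ - ρ * H)) +
    ∑ i, (A i * ρ * (A i)ᴴ - (1 / 2 : ℂ) • ((A i)ᴴ * A i * ρ + ρ * ((A i)ᴴ * A i)))

/-- The family of linear maps `Λ t`, `t ≥ 0`, is the dynamics described by the Lindblad equation:
for every initial state `ρ`, the curve `t ↦ Λ t ρ` starts at `ρ` and solves the equation on
`[0, ∞)` (with the one-sided derivative at `t = 0`). -/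
def IsLindbladDynamics {N : ℕ} (H : Matrix n n ℂ) (A : Fin N → Matrix n n ℂ)
    (Λ : ℝ → Matrix n n ℂ →ₗ[ℂ] Matrix n n ℂ) : Prop :=
  ∀ ρ, IsState ρ → Λ 0 ρ = ρ ∧
    ∀ t : ℝ, 0 ≤ t → HasDerivWithinAt (fun s => Λ s ρ) (lindbladian H A (Λ t ρ)) (Set.Ici 0) t

end QDyn

/-! Conjugate the singlet by a local unitary so that the resulting maximally entangled vector is not
an eigenvector of some non-scalar `A i` (`exists_localVec_not_eigenvector`). By Cauchy–Schwarz its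
overlap with the evolving state then falls at a strictly negative initial rate
(`re_dotProduct_lindbladian_neg`).

In Bloch coordinates, mixing the singlet with white noise is scaling by `p`, and such a mixture is
entangled for `p > 1/3`. At `p = 1/3` the separable set has a single supporting hyperplane, a level
set of the trace of the correlation matrix (`support_eq_corrTrace`). The loss of overlap makes this
trace grow, so the velocity points into the interior of the separable set. Hence `(1/3) • x t₀` is
interior for some `t₀ > 0`, and so is `p • x t` for a slightly larger `p` and all `t` near `t₀`.
Unitality makes `p • x t` the evolution of the noisy entangled state. -/

namespace QDyn

/-! ### Convex geometry of the separable set in Bloch coordinates -/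

/-- The real Bloch coordinates `(a, b, T)` of a two-qubit operator of trace one. -/
abbrev BlochSpace : Type := Fin 3 ⊕ Fin 3 ⊕ (Fin 3 × Fin 3) → ℝ

/-- The Bloch coordinates of the product of the qubit states with Bloch vectors `m` and `n`. -/
def blochProd (m n : Fin 3 → ℝ) : BlochSpace :=
  Sum.elim m (Sum.elim n fun ij => m ij.1 * n ij.2)

/-- The convex hull of the Bloch coordinates of product states. -/
def blochSep : Set BlochSpace :=
  convexHull ℝ {x | ∃ m n : Fin 3 → ℝ, ∑ i, m i ^ 2 ≤ 1 ∧ ∑ i, n i ^ 2 ≤ 1 ∧ x = blochProd m n}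

/-- The Bloch coordinates of the singlet state. -/
def singletBloch : BlochSpace :=
  Sum.elim 0 (Sum.elim 0 fun ij => if ij.1 = ij.2 then -1 else 0)

/-- The trace of the correlation matrix. -/
def corrTrace (x : BlochSpace) : ℝ := ∑ i, x (.inr (.inr (i, i)))

lemma blochProd_mem {m n : Fin 3 → ℝ} (hm : ∑ i, m i ^ 2 ≤ 1) (hn : ∑ i, n i ^ 2 ≤ 1) :
    blochProd m n ∈ blochSep :=
  subset_convexHull ℝ _ ⟨m, n, hm, hn, rfl⟩

lemma convex_blochSep : Convex ℝ blochSep := convex_convexHull ℝ _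

lemma sum_single_sq (i : Fin 3) (r : ℝ) : ∑ k, (Pi.single i r : Fin 3 → ℝ) k ^ 2 = r ^ 2 := by
  fin_cases i <;> simp [Fin.sum_univ_three]

lemma linear_apply_eq (g : BlochSpace →L[ℝ] ℝ) (x : BlochSpace) :
    g x = ∑ i, x (.inl i) * g (Pi.single (.inl i) 1)
      + (∑ i, x (.inr (.inl i)) * g (Pi.single (.inr (.inl i)) 1)
      + ∑ i, ∑ j, x (.inr (.inr (i, j))) * g (Pi.single (.inr (.inr (i, j))) 1)) := by
  have h := LinearMap.pi_apply_eq_sum_univ (g : BlochSpace →ₗ[ℝ] ℝ) x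
  simp only [Fintype.sum_sum_type, Fintype.sum_prod_type, smul_eq_mul,
    ContinuousLinearMap.coe_coe] at h
  rw [h]
  congr 1
  · refine Finset.sum_congr rfl fun i _ => ?_
    congr 2; ext k; simp [Pi.single_apply, eq_comm]
  · congr 1
    · refine Finset.sum_congr rfl fun i _ => ?_
      congr 2; ext k; simp [Pi.single_apply, eq_comm]
    · refine Finset.sum_congr rfl fun i _ => Finset.sum_congr rfl fun j _ => ?_
      congr 2; ext k; simp [Pi.single_apply, eq_comm]

/-- A correlation coordinate vector is a pure product minus its two local Bloch vectors. -/
lemma vectorSpan_blochProd : vectorSpan ℝ {x | ∃ m n : Fin 3 → ℝ, ∑ i, m i ^ 2 ≤ 1 ∧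
    ∑ i, n i ^ 2 ≤ 1 ∧ x = blochProd m n} = ⊤ := by
  set G : Set BlochSpace := {x | ∃ m n : Fin 3 → ℝ, ∑ i, m i ^ 2 ≤ 1 ∧
    ∑ i, n i ^ 2 ≤ 1 ∧ x = blochProd m n} with hG
  have h0 : (0 : BlochSpace) ∈ G :=
    ⟨0, 0, by simp, by simp, by ext (i | i | i) <;> simp [blochProd]⟩
  have hmem : ∀ x ∈ G, x ∈ vectorSpan ℝ G := fun x hx => by
    simpa using vsub_mem_vectorSpan ℝ hx h0
  have h1 : ∀ i, (Pi.single (.inl i) 1 : BlochSpace) ∈ vectorSpan ℝ G := fun i =>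
    hmem _ ⟨Pi.single i 1, 0, by simp [sum_single_sq], by simp, by
      ext (j | j | j) <;> simp [blochProd, Pi.single_apply]⟩
  have h2 : ∀ i, (Pi.single (.inr (.inl i)) 1 : BlochSpace) ∈ vectorSpan ℝ G := fun i =>
    hmem _ ⟨0, Pi.single i 1, by simp, by simp [sum_single_sq], by
      ext (j | j | j) <;> simp [blochProd, Pi.single_apply]⟩
  have h3 : ∀ ij, (Pi.single (.inr (.inr ij)) 1 : BlochSpace) ∈ vectorSpan ℝ G := fun ij => by
    have := Submodule.sub_mem _ (Submodule.sub_mem _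
      (hmem (blochProd (Pi.single ij.1 1) (Pi.single ij.2 1))
        ⟨_, _, by simp [sum_single_sq], by simp [sum_single_sq], rfl⟩) (h1 ij.1)) (h2 ij.2)
    convert this using 1
    ext (j | j | j) <;> simp [blochProd, Pi.single_apply, Prod.ext_iff]
    split_ifs <;> simp_all
  rw [eq_top_iff, ← (Pi.basisFun ℝ _).span_eq, Submodule.span_le]
  rintro _ ⟨(i | i | i), rfl⟩
  · simpa using h1 i
  · simpa using h2 i
  · simpa using h3 i

lemma interior_blochSep_nonempty : (interior blochSep).Nonempty := by
  rw [blochSep, interior_convexHull_nonempty_iff_affineSpan_eq_top,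
    AffineSubspace.affineSpan_eq_top_iff_vectorSpan_eq_top_of_nonempty, vectorSpan_blochProd]
  exact ⟨_, 0, 0, by simp, by simp, rfl⟩

/-- Along each axis the two antiparallel products have cancelling local parts. That all six products
lie on every supporting hyperplane here is what pins the hyperplane down. -/
lemma singletBloch_eq : (1 / 3 : ℝ) • singletBloch = ∑ i, ((1 / 6 : ℝ) •
    blochProd (Pi.single i 1) (Pi.single i (-1)) +
      (1 / 6 : ℝ) • blochProd (Pi.single i (-1)) (Pi.single i 1)) := by
  ext (j | j | ⟨j, k⟩)
  · fin_cases j <;> simp [singletBloch, blochProd, Fin.sum_univ_three]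
  · fin_cases j <;> simp [singletBloch, blochProd, Fin.sum_univ_three]
  · fin_cases j <;> fin_cases k <;> norm_num [singletBloch, blochProd, Fin.sum_univ_three, Pi.single_apply, Fin.ext_iff]

lemma third_singletBloch_mem : (1 / 3 : ℝ) • singletBloch ∈ blochSep := by
  have h := convex_blochSep.sum_mem (t := (Finset.univ : Finset (Fin 3 × Bool)))
    (w := fun _ => 1 / 6) (z := fun p => bif p.2 then blochProd (Pi.single p.1 1)
      (Pi.single p.1 (-1)) else blochProd (Pi.single p.1 (-1)) (Pi.single p.1 1))
    (by intros; norm_num) (by simp) (by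
      rintro ⟨i, (_ | _)⟩ - <;>
      exact blochProd_mem (by simp [sum_single_sq]) (by simp [sum_single_sq]))
  rw [Fintype.sum_prod_type] at h
  rw [singletBloch_eq]
  simpa using h

/-- A linear form on the plane that attains its maximum over the unit disc at `(1, 0)`. -/
lemma eq_zero_of_max_disc {k h : ℝ} (H : ∀ c s : ℝ, c ^ 2 + s ^ 2 ≤ 1 → c * k + s * h ≤ k) :
    h = 0 := by
  by_contra hh
  have hp : 0 < k ^ 2 + h ^ 2 := by positivity
  set N := Real.sqrt (k ^ 2 + h ^ 2)
  have hN : 0 < N := Real.sqrt_pos.2 hp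
  have hN2 : N ^ 2 = k ^ 2 + h ^ 2 := Real.sq_sqrt hp.le
  -- The unit vector along `(k, h)` gives `N ≤ k`.
  have := H (k / N) (h / N) (by rw [div_pow, div_pow, ← add_div, ← hN2, div_self (by positivity)])
  have h2 : k / N * k + h / N * h = N := by field_simp; linarith
  rw [h2] at this
  have : 0 < h ^ 2 := by positivity
  nlinarith

/-- The only supporting functionals of `blochSep` at the separable boundary point of the segment
from the origin to the singlet are multiples of the trace of the correlation matrix. -/
lemma support_eq_corrTrace {g : BlochSpace →L[ℝ] ℝ} {u : ℝ} (hg : ∀ x ∈ blochSep, g x ≤ u)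
    (hu : u ≤ g ((1 / 3 : ℝ) • singletBloch)) (x : BlochSpace) : g x = -u * corrTrace x := by
  set α : Fin 3 → ℝ := fun i => g (Pi.single (.inl i) 1) with hα
  set β : Fin 3 → ℝ := fun i => g (Pi.single (.inr (.inl i)) 1) with hβ
  set τ : Fin 3 → Fin 3 → ℝ := fun i j => g (Pi.single (.inr (.inr (i, j))) 1) with hτ
  have hgx : ∀ x, g x = ∑ i, x (.inl i) * α i + (∑ i, x (.inr (.inl i)) * β i
      + ∑ i, ∑ j, x (.inr (.inr (i, j))) * τ i j) := linear_apply_eq g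
  have hprod : ∀ m n, g (blochProd m n) = ∑ i, m i * α i + (∑ i, n i * β i
      + ∑ i, ∑ j, (m i * n j) * τ i j) := fun m n => by rw [hgx]; rfl
  have hs1 : ∀ (i : Fin 3) (r s : ℝ), r ^ 2 ≤ 1 → s ^ 2 ≤ 1 →
      g (blochProd (Pi.single i r) (Pi.single i s)) ≤ u := fun i r s hr hs =>
    hg _ (blochProd_mem (by rwa [sum_single_sq]) (by rwa [sum_single_sq]))
  have hval : ∀ i r s, g (blochProd (Pi.single i r) (Pi.single i s)) =
      r * α i + (s * β i + r * s * τ i i) := fun i r s => by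
    rw [hprod]; fin_cases i <;> simp [Fin.sum_univ_three]
  rw [singletBloch_eq] at hu
  simp only [map_add, map_smul, smul_eq_mul, Fin.sum_univ_three] at hu
  have hp : ∀ i, g (blochProd (Pi.single i 1) (Pi.single i (-1))) ≤ u := fun i =>
    hs1 i _ _ (by norm_num) (by norm_num)
  have hm : ∀ i, g (blochProd (Pi.single i (-1)) (Pi.single i 1)) ≤ u := fun i =>
    hs1 i _ _ (by norm_num) (by norm_num)
  -- Six values at most `u` with average at least `u` must all equal `u`.
  have hp' : ∀ i, g (blochProd (Pi.single i 1) (Pi.single i (-1))) = u := fun i => by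
    fin_cases i <;> refine le_antisymm (hp _) ?_ <;> simp only [Fin.zero_eta, Fin.mk_one, Fin.reduceFinMk] <;>
    linarith [hp 0, hp 1, hp 2, hm 0, hm 1, hm 2]
  have hm' : ∀ i, g (blochProd (Pi.single i (-1)) (Pi.single i 1)) = u := fun i => by
    fin_cases i <;> refine le_antisymm (hm _) ?_ <;> simp only [Fin.zero_eta, Fin.mk_one, Fin.reduceFinMk] <;>
    linarith [hp 0, hp 1, hp 2, hm 0, hm 1, hm 2]
  simp only [hval] at hp' hm'
  have hτd : ∀ i, τ i i = -u := fun i => by linarith [hp' i, hm' i]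
  have hαβ : ∀ i, α i = β i := fun i => by linarith [hp' i, hm' i]
  have hval2 : ∀ i j, i ≠ j → ∀ r c s : ℝ,
      g (blochProd (Pi.single i r) (Pi.single i c + Pi.single j s)) =
      r * α i + (c * β i + s * β j + (r * c * τ i i + r * s * τ i j)) := fun i j hij r c s => by
    rw [hprod]
    fin_cases i <;> fin_cases j <;> simp [Fin.sum_univ_three] at hij ⊢ <;> ring
  have hle2 : ∀ i j, i ≠ j → ∀ r c s : ℝ, r ^ 2 = 1 → c ^ 2 + s ^ 2 ≤ 1 →
      r * α i + (c * β i + s * β j + (r * c * τ i i + r * s * τ i j)) ≤ u :=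
    fun i j hij r c s hr hcs => by
      rw [← hval2 i j hij]
      refine hg _ (blochProd_mem (by simp [sum_single_sq, hr]) ?_)
      fin_cases i <;> fin_cases j <;> simp [Fin.sum_univ_three] at hij ⊢ <;> linarith
  -- With the first Bloch vector fixed at an axis, the second moves in a disc and is optimal at the
  -- antipode, so the tangential coefficient vanishes.
  have hplus : ∀ i j, i ≠ j → β j + τ i j = 0 := fun i j hij => by
    refine eq_zero_of_max_disc (k := -(β i) + u) fun c s hcs => ?_
    have := hle2 i j hij 1 (-c) s (by norm_num) (by simpa using hcs)
    rw [hτd] at this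
    linarith [hαβ i]
  have hminus : ∀ i j, i ≠ j → β j - τ i j = 0 := fun i j hij => by
    refine eq_zero_of_max_disc (k := β i + u) fun c s hcs => ?_
    have := hle2 i j hij (-1) c s (by norm_num) hcs
    rw [hτd] at this
    linarith [hαβ i]
  have hβ0 : ∀ j, β j = 0 := fun j => by
    obtain ⟨i, hij⟩ : ∃ i, i ≠ j := exists_ne j
    linarith [hplus i j hij, hminus i j hij]
  have hτ0 : ∀ i j, i ≠ j → τ i j = 0 := fun i j hij => by
    linarith [hplus i j hij, hminus i j hij]
  rw [hgx]
  simp only [hαβ, hβ0, Fin.sum_univ_three, hτd, hτ0 0 1 (by decide), hτ0 0 2 (by decide),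
    hτ0 1 0 (by decide), hτ0 1 2 (by decide), hτ0 2 0 (by decide), hτ0 2 1 (by decide), corrTrace]
  ring

lemma zero_mem_blochSep : (0 : BlochSpace) ∈ blochSep := by
  have := blochProd_mem (m := 0) (n := 0) (by simp) (by simp)
  convert this using 1
  ext (i | i | i) <;> simp [blochProd]

/-- Otherwise Hahn–Banach separates the ray from the interior by a functional supporting at its
origin, hence `-u * corrTrace` with `u ≥ 0`. Being nonnegative on `d`, it is zero, against
strictness on the interior. -/
lemma exists_add_smul_mem_interior {d : BlochSpace} (hd : 0 < corrTrace d) :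
    ∃ s : ℝ, 0 < s ∧ (1 / 3 : ℝ) • singletBloch + s • d ∈ interior blochSep := by
  by_contra! hcon
  set c := (1 / 3 : ℝ) • singletBloch with hc
  have hR : Convex ℝ ((fun s : ℝ => c + s • d) '' Set.Ioi 0) := by
    have : (fun s : ℝ => c + s • d) '' Set.Ioi 0 =
        (fun y => c + y) '' ((LinearMap.toSpanSingleton ℝ BlochSpace d) '' Set.Ioi 0) := by
      rw [Set.image_image]; rfl
    rw [this]
    exact ((convex_Ioi 0).linear_image _).translate c
  obtain ⟨g, u, hlt, hle⟩ := geometric_hahn_banach_open convex_blochSep.interior isOpen_interior hR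
    (by
      rw [Set.disjoint_right]
      rintro _ ⟨s, hs, rfl⟩
      exact hcon s hs)
  have hS : ∀ x ∈ blochSep, g x ≤ u := by
    intro x hx
    have hx' : x ∈ closure (interior blochSep) := by
      rw [convex_blochSep.closure_interior_eq_closure_of_nonempty_interior
        interior_blochSep_nonempty]
      exact subset_closure hx
    exact closure_minimal (fun y hy => (hlt y hy).le)
      (isClosed_le g.continuous continuous_const) hx'
  have hray : ∀ s : ℝ, 0 < s → u ≤ g c + s * g d := fun s hs => by
    simpa using hle _ ⟨s, hs, rfl⟩
  have hgc : u ≤ g c := by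
    have ht : Filter.Tendsto (fun s : ℝ => g c + s * g d) (nhdsWithin 0 (Set.Ioi 0))
        (nhds (g c + 0 * g d)) :=
      Filter.Tendsto.mono_left ((by fun_prop : Continuous fun s : ℝ => g c + s * g d).tendsto 0)
        nhdsWithin_le_nhds
    have := ge_of_tendsto ht (Filter.eventually_of_mem self_mem_nhdsWithin hray)
    simpa using this
  have hform := support_eq_corrTrace hS hgc
  have h0 : 0 ≤ u := by simpa using hS 0 zero_mem_blochSep
  have h1 : 0 ≤ g d := by
    have := hray 1 one_pos
    have h2 := hS c third_singletBloch_mem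
    linarith
  have hu0 : u = 0 := by
    rw [hform] at h1
    nlinarith
  obtain ⟨y, hy⟩ := interior_blochSep_nonempty
  have := hlt y hy
  rw [hform, hu0] at this
  simp at this

/-- A curve that starts at the singlet and leaves it with increasing correlation trace enters the
separable set, after mixing with slightly less noise than the singlet needs. -/
lemma exists_smul_mem_blochSep {x : ℝ → BlochSpace} {d : BlochSpace} (hx0 : x 0 = singletBloch)
    (hx : ContinuousOn x (Set.Ici 0)) (hd : HasDerivWithinAt x d (Set.Ici 0) 0)
    (hpos : 0 < corrTrace d) :
    ∃ p : ℝ, 1 / 3 < p ∧ p < 1 ∧ ∃ a b : ℝ, 0 < a ∧ a < b ∧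
      ∀ t, a < t → t < b → p • x t ∈ blochSep := by
  obtain ⟨s, hs, hint⟩ := exists_add_smul_mem_interior hpos
  have hslope : Filter.Tendsto (fun t => (1 / 3 : ℝ) • singletBloch + s • slope x 0 t)
      (nhdsWithin 0 (Set.Ioi 0)) (nhds ((1 / 3 : ℝ) • singletBloch + s • d)) := by
    have := (hasDerivWithinAt_iff_tendsto_slope.1 hd)
    rw [Set.Ici_sdiff_left] at this
    exact (this.const_smul s).const_add _
  have hev1 := hslope.eventually (isOpen_interior.mem_nhds hint)
  have hev2 : ∀ᶠ t : ℝ in nhdsWithin 0 (Set.Ioi 0), t < 3 * s := 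
    Filter.Eventually.filter_mono nhdsWithin_le_nhds (gt_mem_nhds (by positivity))
  obtain ⟨t₀, ⟨h1, h2⟩, ht₀⟩ := ((hev1.and hev2).and self_mem_nhdsWithin).exists
  replace ht₀ : 0 < t₀ := ht₀
  have hin : (1 / 3 : ℝ) • x t₀ ∈ interior blochSep := by
    -- `(1/3) • x t₀` lies on the segment from the boundary point to the interior point `(1/3) •
    -- singletBloch + s • slope x 0 t₀`, with weight `t₀ / (3 * s)`.
    have := convex_blochSep.combo_self_interior_mem_interior third_singletBloch_mem h1
      (a := 1 - t₀ / (3 * s)) (b := t₀ / (3 * s))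
      (by rw [sub_nonneg, div_le_one (by positivity)]; exact h2.le) (by positivity) (by ring)
    convert this using 1
    rw [slope_def_module, hx0]
    ext k
    simp only [Pi.smul_apply, Pi.add_apply, Pi.sub_apply, smul_eq_mul, sub_zero]
    field_simp
    ring
  have hcp : Filter.Tendsto (fun p : ℝ => p • x t₀) (nhdsWithin (1 / 3) (Set.Ioi (1 / 3)))
      (nhds ((1 / 3 : ℝ) • x t₀)) :=
    Filter.Tendsto.mono_left ((by fun_prop : Continuous fun p : ℝ => p • x t₀).tendsto _)
      nhdsWithin_le_nhds
  have hev3 : ∀ᶠ p : ℝ in nhdsWithin (1 / 3) (Set.Ioi (1 / 3)), p < 1 :=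
    Filter.Eventually.filter_mono nhdsWithin_le_nhds (gt_mem_nhds (by norm_num))
  obtain ⟨p, ⟨hp1, hp2⟩, hp3⟩ := (((hcp.eventually (isOpen_interior.mem_nhds hin)).and hev3).and
    self_mem_nhdsWithin).exists
  have hct : ContinuousAt (fun t => p • x t) t₀ :=
    (hx.continuousAt (Ici_mem_nhds ht₀)).const_smul p
  have hev4 := hct.eventually (isOpen_interior.mem_nhds hp1)
  obtain ⟨l, r, ⟨hl, hr⟩, hlr⟩ := mem_nhds_iff_exists_Ioo_subset.1
    (Filter.inter_mem hev4 (Ioi_mem_nhds ht₀))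
  refine ⟨p, hp3, hp2, t₀, r, ht₀, hr, fun t ht htr => interior_subset ?_⟩
  exact (hlr ⟨hl.trans ht, htr⟩).1

/-! ### Linear differential equations and the Lindblad generator -/

/-- Uniqueness of the zero solution of a linear differential equation on `[0, ∞)`. -/
lemma eq_zero_of_linear_ode {F : Type*} [NormedAddCommGroup F] [NormedSpace ℝ F] (v : F →L[ℝ] F)
    {x : ℝ → F} (h0 : x 0 = 0)
    (hx : ∀ t : ℝ, 0 ≤ t → HasDerivWithinAt x (v (x t)) (Set.Ici 0) t) {t : ℝ} (ht : 0 ≤ t) :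
    x t = 0 := by
  have hcont : ContinuousOn x (Set.Icc 0 t) := fun s hs =>
    (hx s hs.1).continuousWithinAt.mono Set.Icc_subset_Ici_self
  refine ODE_solution_unique_of_mem_Icc_right (v := fun _ => v) (s := fun _ => Set.univ)
    (K := ‖v‖₊) (f := x) (g := fun _ => 0) (a := 0) (b := t)
    (fun s _ => v.lipschitz.lipschitzOnWith) hcont
    (fun s hs => (hx s hs.1).mono (Set.Ici_subset_Ici.2 hs.1)) (fun _ _ => trivial)
    continuousOn_const (fun s _ => ?_) (fun _ _ => trivial) h0 ⟨ht, le_rfl⟩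
  simpa using hasDerivWithinAt_const s (Set.Ici s) (0 : F)

section Lindblad

variable {n : Type*} [Fintype n] {N : ℕ}

/-- The Lindblad generator as a linear map. -/
noncomputable def lindbladianₗ (H : Matrix n n ℂ) (A : Fin N → Matrix n n ℂ) :
    Matrix n n ℂ →ₗ[ℂ] Matrix n n ℂ where
  toFun := lindbladian H A
  map_add' ρ σ := by
    simp only [lindbladian, mul_add, add_mul, smul_add, Finset.sum_add_distrib,
      Finset.sum_sub_distrib, smul_sub]
    abel
  map_smul' c ρ := by
    simp only [lindbladian, mul_smul_comm, smul_mul_assoc, RingHom.id_apply, smul_add, smul_neg,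
      Finset.smul_sum, smul_sub, smul_comm c]

lemma lindbladian_conjTranspose {H : Matrix n n ℂ} (hH : H.IsHermitian)
    (A : Fin N → Matrix n n ℂ) (ρ : Matrix n n ℂ) :
    (lindbladian H A ρ)ᴴ = lindbladian H A ρᴴ := by
  simp only [lindbladian, Matrix.conjTranspose_add, Matrix.conjTranspose_neg,
    Matrix.conjTranspose_smul, Matrix.conjTranspose_sub, Matrix.conjTranspose_mul,
    Matrix.conjTranspose_sum, hH.eq, Matrix.conjTranspose_conjTranspose]
  congr 1
  · simp [sub_eq_add_neg, add_comm]
  · refine Finset.sum_congr rfl fun i _ => ?_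
    simp [mul_assoc, add_comm]

lemma trace_lindbladian (H : Matrix n n ℂ) (A : Fin N → Matrix n n ℂ) (ρ : Matrix n n ℂ) :
    (lindbladian H A ρ).trace = 0 := by
  simp only [lindbladian, Matrix.trace_add, Matrix.trace_neg, Matrix.trace_smul, Matrix.trace_sub,
    Matrix.trace_sum, Matrix.trace_mul_comm ρ, sub_self, smul_zero, neg_zero, zero_add]
  refine Finset.sum_eq_zero fun i _ => ?_
  rw [Matrix.trace_mul_comm (A i * ρ), ← mul_assoc, smul_eq_mul]
  ring

lemma lindbladian_one [DecidableEq n] (H : Matrix n n ℂ) (A : Fin N → Matrix n n ℂ)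
    (hunital : ∑ i, (A i * (A i)ᴴ - (A i)ᴴ * A i) = 0) : lindbladian H A 1 = 0 := by
  rw [lindbladian, ← hunital]
  simp only [mul_one, one_mul, sub_self, smul_zero, neg_zero, zero_add]
  refine Finset.sum_congr rfl fun i _ => ?_
  rw [← two_smul ℂ, smul_smul]
  norm_num

variable {H : Matrix n n ℂ} {A : Fin N → Matrix n n ℂ}

section Norm

attribute [local instance] Matrix.normedAddCommGroup Matrix.normedSpace

lemma lindblad_unique {X : ℝ → Matrix n n ℂ} (h0 : X 0 = 0)
    (hX : ∀ t : ℝ, 0 ≤ t → HasDerivWithinAt X (lindbladian H A (X t)) (Set.Ici 0) t)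
    {t : ℝ} (ht : 0 ≤ t) : X t = 0 :=
  eq_zero_of_linear_ode
    (LinearMap.toContinuousLinearMap ((lindbladianₗ H A).restrictScalars ℝ)) h0 hX ht

/-- Real-linear maps between finite-dimensional spaces preserve one-sided derivatives. -/
lemma hasDerivWithinAt_linear {F : Type*} [NormedAddCommGroup F] [NormedSpace ℝ F]
    (φ : Matrix n n ℂ →ₗ[ℝ] F) {X : ℝ → Matrix n n ℂ} {D : Matrix n n ℂ} {s : Set ℝ} {t : ℝ}
    (hX : HasDerivWithinAt X D s t) : HasDerivWithinAt (fun r => φ (X r)) (φ D) s t :=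
  (LinearMap.toContinuousLinearMap φ).hasFDerivAt.comp_hasDerivWithinAt t hX

lemma hasDerivWithinAt_linear' {m : Type*} [Fintype m]
    (φ : Matrix n n ℂ →ₗ[ℝ] Matrix m m ℂ) {X : ℝ → Matrix n n ℂ} {D : Matrix n n ℂ} {s : Set ℝ}
    {t : ℝ} (hX : HasDerivWithinAt X D s t) : HasDerivWithinAt (fun r => φ (X r)) (φ D) s t :=
  hasDerivWithinAt_linear φ hX

end Norm

variable {Λ : ℝ → Matrix n n ℂ →ₗ[ℂ] Matrix n n ℂ}

/-- The generator commutes with the adjoint. Hermiticity and trace one suffice for Bloch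
coordinates; positivity of `Λ t ρ` is never needed. -/
lemma isHermitian_dynamics (hH : H.IsHermitian) (hΛ : IsLindbladDynamics H A Λ)
    {ρ : Matrix n n ℂ} (hρ : IsState ρ) {t : ℝ} (ht : 0 ≤ t) : (Λ t ρ).IsHermitian := by
  let φ : Matrix n n ℂ →ₗ[ℝ] Matrix n n ℂ :=
    { toFun := fun M => Mᴴ - M
      map_add' := fun M M' => by rw [Matrix.conjTranspose_add]; abel
      map_smul' := fun c M => by simp [smul_sub, Matrix.conjTranspose_smul] }
  refine sub_eq_zero.1 (lindblad_unique (H := H) (A := A) (X := fun t => φ (Λ t ρ)) ?_ ?_ ht)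
  · simp [φ, (hΛ ρ hρ).1, hρ.1.isHermitian.eq]
  · intro s hs
    have := hasDerivWithinAt_linear' φ ((hΛ ρ hρ).2 s hs)
    convert this using 1
    change lindbladian H A ((Λ s ρ)ᴴ - Λ s ρ) = (lindbladian H A (Λ s ρ))ᴴ - lindbladian H A (Λ s ρ)
    rw [lindbladian_conjTranspose hH]
    exact map_sub (lindbladianₗ H A) _ _

lemma trace_dynamics (hΛ : IsLindbladDynamics H A Λ)
    {ρ : Matrix n n ℂ} (hρ : IsState ρ) {t : ℝ} (ht : 0 ≤ t) : (Λ t ρ).trace = 1 := by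
  refine sub_eq_zero.1 (eq_zero_of_linear_ode (0 : ℂ →L[ℝ] ℂ)
    (x := fun t => (Λ t ρ).trace - 1) ?_ ?_ ht)
  · simp [(hΛ ρ hρ).1, hρ.2]
  · intro s hs
    have := hasDerivWithinAt_linear (Matrix.traceLinearMap n ℝ ℂ) ((hΛ ρ hρ).2 s hs)
    simpa [trace_lindbladian] using this.sub_const 1

section Norm

attribute [local instance] Matrix.normedAddCommGroup Matrix.normedSpace

lemma dynamics_one [DecidableEq n] [Nonempty n] (hΛ : IsLindbladDynamics H A Λ)
    (hunital : ∑ i, (A i * (A i)ᴴ - (A i)ᴴ * A i) = 0) {t : ℝ} (ht : 0 ≤ t) : Λ t 1 = 1 := by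
  have hc : (Fintype.card n : ℂ) ≠ 0 := by simp
  -- The equation is given for states only, so the stationary solution is the maximally mixed state,
  -- rescaled at the end.
  set ρ : Matrix n n ℂ := (Fintype.card n : ℂ)⁻¹ • 1 with hρ
  have hst : IsState ρ := by
    refine ⟨Matrix.PosSemidef.one.smul (by positivity), ?_⟩
    rw [hρ, Matrix.trace_smul, Matrix.trace_one, smul_eq_mul, inv_mul_cancel₀ hc]
  have hL : lindbladian H A ρ = 0 := by
    have := (lindbladianₗ H A).map_smul (Fintype.card n : ℂ)⁻¹ 1
    exact this.trans (by rw [show lindbladianₗ H A 1 = 0 from lindbladian_one H A hunital, smul_zero])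
  have h : Λ t ρ = ρ := by
    refine sub_eq_zero.1 (lindblad_unique (H := H) (A := A) (X := fun t => Λ t ρ - ρ) ?_ ?_ ht)
    · simp [(hΛ ρ hst).1]
    · intro s hs
      have h1 : lindbladian H A (Λ s ρ - ρ) = lindbladian H A (Λ s ρ) :=
        ((lindbladianₗ H A).map_sub _ _).trans (by
          rw [show lindbladianₗ H A ρ = 0 from hL, sub_zero]; rfl)
      rw [h1]
      exact ((hΛ ρ hst).2 s hs).sub_const ρ
  rw [hρ, map_smul] at h
  exact smul_right_injective _ (inv_ne_zero hc) h

end Norm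

/-- The Hamiltonian part cancels; each summand is minus the Cauchy–Schwarz defect of `v` and `A i *ᵥ
v`. -/
lemma dotProduct_lindbladian_vecMulVec (H : Matrix n n ℂ) (A : Fin N → Matrix n n ℂ) (v : n → ℂ) :
    star v ⬝ᵥ lindbladian H A (Matrix.vecMulVec v (star v)) *ᵥ v =
      ∑ i, ((star v ⬝ᵥ A i *ᵥ v) * star (star v ⬝ᵥ A i *ᵥ v) -
        (star v ⬝ᵥ v) * (star (A i *ᵥ v) ⬝ᵥ A i *ᵥ v)) := by
  have key : ∀ B C : Matrix n n ℂ, star v ⬝ᵥ (B * Matrix.vecMulVec v (star v) * C) *ᵥ v =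
      (star v ⬝ᵥ B *ᵥ v) * (star v ⬝ᵥ C *ᵥ v) := fun B C => by
    rw [← Matrix.mulVec_mulVec, ← Matrix.mulVec_mulVec, Matrix.vecMulVec_mulVec]
    simp [Matrix.mulVec_smul, mul_comm]
  classical
  have keyl : ∀ B : Matrix n n ℂ, star v ⬝ᵥ (B * Matrix.vecMulVec v (star v)) *ᵥ v =
      (star v ⬝ᵥ B *ᵥ v) * (star v ⬝ᵥ v) := fun B => by simpa using key B 1
  have keyr : ∀ C : Matrix n n ℂ, star v ⬝ᵥ (Matrix.vecMulVec v (star v) * C) *ᵥ v =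
      (star v ⬝ᵥ v) * (star v ⬝ᵥ C *ᵥ v) := fun C => by simpa using key 1 C
  have hadj : ∀ B : Matrix n n ℂ, star v ⬝ᵥ Bᴴ *ᵥ v = star (star v ⬝ᵥ B *ᵥ v) := fun B => by
    rw [Matrix.star_dotProduct, Matrix.star_mulVec, Matrix.dotProduct_mulVec,
      Matrix.conjTranspose_conjTranspose]
  have hsq : ∀ B : Matrix n n ℂ, star v ⬝ᵥ (Bᴴ * B) *ᵥ v = star (B *ᵥ v) ⬝ᵥ B *ᵥ v := fun B => by
    rw [← Matrix.mulVec_mulVec, Matrix.dotProduct_mulVec, Matrix.star_mulVec]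
  simp only [lindbladian, Matrix.add_mulVec, Matrix.neg_mulVec, Matrix.smul_mulVec,
    Matrix.sub_mulVec, Matrix.sum_mulVec, dotProduct_add, dotProduct_neg, dotProduct_smul,
    dotProduct_sub, dotProduct_sum, key, keyl, keyr, hadj, hsq]
  rw [mul_comm (star v ⬝ᵥ H *ᵥ v), sub_self, smul_zero, neg_zero, zero_add]
  refine Finset.sum_congr rfl fun i _ => ?_
  rw [smul_eq_mul]; ring

/-- A vector that is not an eigenvector of some `A i` gives a state that loses purity. -/
lemma re_dotProduct_lindbladian_neg (H : Matrix n n ℂ) (A : Fin N → Matrix n n ℂ) {v : n → ℂ}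
    (hv : v ≠ 0) {i : Fin N} (hi : ∀ μ : ℂ, A i *ᵥ v ≠ μ • v) :
    (star v ⬝ᵥ lindbladian H A (Matrix.vecMulVec v (star v)) *ᵥ v).re < 0 := by
  have hr : 0 < star v ⬝ᵥ v := Matrix.dotProduct_star_self_pos_iff.2 hv
  set r := star v ⬝ᵥ v with hr'
  have hrs : star r = r := (Matrix.star_dotProduct v v).symm
  -- The vector is `r` times the component of `A j *ᵥ v` orthogonal to `v`.
  have hid : ∀ j, star (r • A j *ᵥ v - (star v ⬝ᵥ A j *ᵥ v) • v) ⬝ᵥ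
      (r • A j *ᵥ v - (star v ⬝ᵥ A j *ᵥ v) • v) = - r * ((star v ⬝ᵥ A j *ᵥ v) *
        star (star v ⬝ᵥ A j *ᵥ v) - r * (star (A j *ᵥ v) ⬝ᵥ A j *ᵥ v)) := fun j => by
    have h1 : star (A j *ᵥ v) ⬝ᵥ v = star (star v ⬝ᵥ A j *ᵥ v) := by
      rw [Matrix.star_dotProduct, dotProduct_comm]
    simp only [star_sub, star_smul, sub_dotProduct, dotProduct_sub, smul_dotProduct,
      dotProduct_smul, h1, hrs, ← hr', smul_eq_mul]
    ring
  rw [dotProduct_lindbladian_vecMulVec, Complex.re_sum, ← hr']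
  have hre : ∀ z w : ℂ, w = -r * z → 0 ≤ w → z.re ≤ 0 ∧ (w ≠ 0 → z.re < 0) := by
    intro z w hw h0
    have hrr : r = (r.re : ℂ) := by
      apply Complex.ext <;> simp [(Complex.lt_def.1 hr).2.symm]
    have hrp : 0 < r.re := (Complex.lt_def.1 hr).1
    have h1 : w.re = -(r.re * z.re) := by rw [hw, hrr]; simp
    have h2 := (Complex.le_def.1 h0)
    simp only [Complex.zero_re, Complex.zero_im] at h2
    constructor
    · by_contra! h; nlinarith [mul_pos hrp h]
    · intro hne
      by_contra! h
      refine hne (Complex.ext ?_ h2.2.symm)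
      have := mul_nonneg hrp.le h
      simp only [Complex.zero_re]; linarith [h2.1]
  refine Finset.sum_neg' (fun j _ => (hre _ _ (hid j) (dotProduct_star_self_nonneg _)).1)
    ⟨i, Finset.mem_univ i, (hre _ _ (hid i) (dotProduct_star_self_nonneg _)).2 ?_⟩
  rw [Ne, dotProduct_star_self_eq_zero, sub_eq_zero]
  intro h
  refine hi (r⁻¹ * (star v ⬝ᵥ A i *ᵥ v)) ?_
  rw [mul_smul, ← h, smul_smul, inv_mul_cancel₀ hr.ne', one_smul]

end Lindblad

/-! ### Pauli coordinates and noisy singlets -/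

/-- The Pauli matrices. -/
def pauli : Fin 3 → Matrix (Fin 2) (Fin 2) ℂ :=
  ![!![0, 1; 1, 0], !![0, -Complex.I; Complex.I, 0], !![1, 0; 0, -1]]

/-- Nontrivial products of Pauli matrices and the identity. -/
def pauliProd : Fin 3 ⊕ Fin 3 ⊕ (Fin 3 × Fin 3) → Matrix (Fin 2 × Fin 2) (Fin 2 × Fin 2) ℂ :=
  Sum.elim (fun i => pauli i ⊗ₖ 1) (Sum.elim (fun j => 1 ⊗ₖ pauli j)
    fun ij => pauli ij.1 ⊗ₖ pauli ij.2)

/-- The two-qubit operator of trace one with given Bloch coordinates. -/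
noncomputable def blochMatrix (x : BlochSpace) : Matrix (Fin 2 × Fin 2) (Fin 2 × Fin 2) ℂ :=
  (1 / 4 : ℂ) • (1 + Fintype.linearCombination ℝ pauliProd x)

/-- The Bloch coordinates of a two-qubit operator. -/
noncomputable def blochCoord : Matrix (Fin 2 × Fin 2) (Fin 2 × Fin 2) ℂ →ₗ[ℝ] BlochSpace where
  toFun Y k := (Y * pauliProd k).trace.re
  map_add' Y Z := by ext k; simp [add_mul]
  map_smul' c Y := by ext k; simp

/-- The qubit state with given Bloch vector. -/
noncomputable def qubit (m : Fin 3 → ℝ) : Matrix (Fin 2) (Fin 2) ℂ :=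
  (1 / 2 : ℂ) • (1 + ∑ i, (m i : ℂ) • pauli i)

/-- The singlet vector (of squared norm two). -/
def singletVec : Fin 2 × Fin 2 → ℂ := fun p => !![0, 1; -1, 0] p.1 p.2

lemma isState_qubit {m : Fin 3 → ℝ} (hm : ∑ i, m i ^ 2 ≤ 1) : IsState (qubit m) := by
  -- Cayley–Hamilton for a Hermitian matrix of trace one and determinant `(1 - |m|²) / 4`.
  have h : qubit m = qubit m * (qubit m)ᴴ +
      (((1 - ∑ i, m i ^ 2) / 4 : ℝ) : ℂ) • (1 : Matrix (Fin 2) (Fin 2) ℂ) := by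
    ext i j
    fin_cases i <;> fin_cases j <;> apply Complex.ext <;>
      simp [qubit, pauli, Fin.sum_univ_three, Matrix.mul_apply, Fin.sum_univ_two,
        Matrix.one_apply, -Complex.ofReal_sub, -Complex.ofReal_div, -Complex.ofReal_sum] <;> ring
  refine ⟨?_, ?_⟩
  · rw [h]
    refine (Matrix.posSemidef_self_mul_conjTranspose _).add (Matrix.PosSemidef.one.smul ?_)
    exact_mod_cast div_nonneg (sub_nonneg.2 hm) (by norm_num)
  · simp [qubit, pauli, Fin.sum_univ_three, Matrix.trace_fin_two]

lemma blochMatrix_blochProd (m n : Fin 3 → ℝ) :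
    blochMatrix (blochProd m n) = qubit m ⊗ₖ qubit n := by
  ext ⟨i, i'⟩ ⟨j, j'⟩
  fin_cases i <;> fin_cases i' <;> fin_cases j <;> fin_cases j' <;>
    simp [blochMatrix, blochProd, Fintype.linearCombination_apply, pauliProd, qubit, pauli,
      Fin.sum_univ_three, Fintype.sum_prod_type, Matrix.kroneckerMap_apply] <;>
    first
    | ring1
    | (ring_nf; rw [Complex.I_sq]; ring1)

lemma blochMatrix_smul (p : ℝ) (x : BlochSpace) :
    blochMatrix (p • x) = (p : ℂ) • blochMatrix x + ((1 - p) / 4 : ℂ) • 1 := by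
  rw [blochMatrix, blochMatrix, map_smul]
  ext i j
  simp
  ring

lemma isSeparable_blochMatrix {x : BlochSpace} (hx : x ∈ blochSep) :
    IsSeparable (blochMatrix x) := by
  refine convexHull_min (t := {x | IsSeparable (blochMatrix x)}) ?_ ?_ hx
  · rintro _ ⟨m, n, hm, hn, rfl⟩
    exact subset_convexHull ℝ _ ⟨_, _, isState_qubit hm, isState_qubit hn,
      blochMatrix_blochProd m n⟩
  · intro x hx y hy a b ha hb hab
    have := convex_convexHull ℝ (productStates (Fin 2) (Fin 2)) hx hy ha hb hab
    change blochMatrix (a • x + b • y) ∈ convexHull ℝ (productStates (Fin 2) (Fin 2))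
    convert this using 1
    have hab' : (1 : ℂ) = a + b := by exact_mod_cast hab.symm
    simp only [blochMatrix, map_add, map_smul]
    ext i j
    simp
    linear_combination (4⁻¹ * (1 : Matrix (Fin 2 × Fin 2) (Fin 2 × Fin 2) ℂ) i j) * hab'

lemma trace_mul_kronecker (Y : Matrix (Fin 2 × Fin 2) (Fin 2 × Fin 2) ℂ)
    (σ τ : Matrix (Fin 2) (Fin 2) ℂ) : (Y * σ ⊗ₖ τ).trace =
      ∑ i, ∑ j, ∑ k, ∑ l, Y (i, j) (k, l) * (σ k i * τ l j) := by
  simp [Matrix.trace, Matrix.mul_apply, Fintype.sum_prod_type, Matrix.kroneckerMap_apply]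

-- The identity and the Pauli products form an orthogonal real basis of the Hermitian matrices.
set_option maxHeartbeats 2000000 in
lemma blochMatrix_blochCoord {Y : Matrix (Fin 2 × Fin 2) (Fin 2 × Fin 2) ℂ} (hY : Y.IsHermitian)
    (htr : Y.trace = 1) : blochMatrix (blochCoord Y) = Y := by
  have hre : ∀ p q, (Y p q).re = (Y q p).re := fun p q => by
    rw [← hY.apply p q]; simp
  have him : ∀ p q, (Y p q).im = -(Y q p).im := fun p q => by
    rw [← hY.apply p q]; simp
  have him0 : ∀ p, (Y p p).im = 0 := fun p => by linarith [him p p]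
  have htr' := congrArg Complex.re htr
  simp [Matrix.trace, Fintype.sum_prod_type] at htr'
  have hc : ∀ k, blochCoord Y k = (Y * pauliProd k).trace.re := fun _ => rfl
  have h1 := fun i => hc (.inl i)
  have h2 := fun i => hc (.inr (.inl i))
  have h3 := fun i j => hc (.inr (.inr (i, j)))
  simp only [pauliProd, Sum.elim_inl, Sum.elim_inr, trace_mul_kronecker] at h1 h2 h3
  simp [Fin.forall_fin_succ, pauli, him0] at h1 h2 h3
  ext ⟨i, i'⟩ ⟨j, j'⟩
  fin_cases i <;> fin_cases i' <;> fin_cases j <;> fin_cases j' <;> apply Complex.ext <;>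
    simp [blochMatrix, Fintype.linearCombination_apply, pauliProd, pauli,
      Fin.sum_univ_three, Fintype.sum_prod_type, Matrix.kroneckerMap_apply, him0, h1, h2, h3] <;>
    linarith [htr', hre (0, 0) (0, 1), hre (0, 0) (1, 0), hre (0, 0) (1, 1), hre (0, 1) (1, 0),
      hre (0, 1) (1, 1), hre (1, 0) (1, 1), him (0, 0) (0, 1), him (0, 0) (1, 0),
      him (0, 0) (1, 1), him (0, 1) (1, 0), him (0, 1) (1, 1), him (1, 0) (1, 1)]

lemma blochMatrix_singletBloch :
    blochMatrix singletBloch = (1 / 2 : ℂ) • Matrix.vecMulVec singletVec (star singletVec) := by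
  ext ⟨i, i'⟩ ⟨j, j'⟩
  fin_cases i <;> fin_cases i' <;> fin_cases j <;> fin_cases j' <;>
    simp [blochMatrix, singletBloch, Fintype.linearCombination_apply, pauliProd, pauli,
      Fin.sum_univ_three, Fintype.sum_prod_type, Matrix.kroneckerMap_apply, singletVec,
      Matrix.vecMulVec_apply] <;>
    norm_num

lemma blochCoord_blochMatrix_singlet : blochCoord (blochMatrix singletBloch) = singletBloch := by
  rw [blochMatrix_singletBloch]
  ext (i | i | ⟨i, j⟩)
  · fin_cases i <;> simp [blochCoord, pauliProd, pauli, singletVec, singletBloch,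
      Fintype.sum_prod_type, Matrix.kroneckerMap_apply, Matrix.trace, Matrix.mul_apply,
      Matrix.vecMulVec_apply]
  · fin_cases i <;> simp [blochCoord, pauliProd, pauli, singletVec, singletBloch,
      Fintype.sum_prod_type, Matrix.kroneckerMap_apply, Matrix.trace, Matrix.mul_apply,
      Matrix.vecMulVec_apply]
  · fin_cases i <;> fin_cases j <;> simp [blochCoord, pauliProd, pauli, singletVec, singletBloch,
      Fintype.sum_prod_type, Matrix.kroneckerMap_apply, Matrix.trace, Matrix.mul_apply,
      Matrix.vecMulVec_apply] <;> norm_num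

/-- The sum of the `pauli i ⊗ₖ pauli i` is the identity minus twice the rank-one operator of
`singletVec`. -/
lemma corrTrace_blochCoord (Y : Matrix (Fin 2 × Fin 2) (Fin 2 × Fin 2) ℂ) :
    corrTrace (blochCoord Y) = Y.trace.re - 2 * (star singletVec ⬝ᵥ Y *ᵥ singletVec).re := by
  simp [corrTrace, blochCoord, pauliProd, pauli, singletVec, Fin.sum_univ_three,
    Fintype.sum_prod_type, Matrix.kroneckerMap_apply, Matrix.trace, Matrix.mul_apply, dotProduct,
    Matrix.mulVec]
  ring

lemma trace_mul_nonneg {n : Type*} [Fintype n] {σ τ : Matrix n n ℂ} (hσ : σ.PosSemidef)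
    (hτ : τ.PosSemidef) : 0 ≤ (σ * τ).trace := by
  classical
  open scoped MatrixOrder in
  obtain ⟨B, rfl⟩ := CStarAlgebra.nonneg_iff_eq_star_mul_self.1 hσ.nonneg
  rw [mul_assoc, Matrix.trace_mul_comm, Matrix.star_eq_conjTranspose]
  exact (hτ.mul_mul_conjTranspose_same B).trace_nonneg

lemma neg_one_le_corrTrace {ρ : Matrix (Fin 2 × Fin 2) (Fin 2 × Fin 2) ℂ} (hρ : IsSeparable ρ) :
    -1 ≤ corrTrace (blochCoord ρ) := by
  refine convexHull_min (t := {ρ | -1 ≤ corrTrace (blochCoord ρ)}) ?_ ?_ hρ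
  · rintro _ ⟨σ, τ, hσ, hτ, rfl⟩
    have h := (Complex.le_def.1 (trace_mul_nonneg hσ.1 hτ.1)).1
    have h1 := hσ.2
    have h2 : σ.trace * τ.trace = 1 := by rw [h1, hτ.2, one_mul]
    -- The rank-one operator of `singletVec` is the identity minus the swap.
    have h3 : (star singletVec ⬝ᵥ (σ ⊗ₖ τ) *ᵥ singletVec) =
        σ.trace * τ.trace - (σ * τ).trace := by
      simp [singletVec, Fintype.sum_prod_type, Matrix.trace, Matrix.mul_apply, dotProduct,
        Matrix.mulVec]
      ring
    change -1 ≤ corrTrace (blochCoord (σ ⊗ₖ τ))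
    rw [corrTrace_blochCoord, h3, Matrix.trace_kronecker, h2]
    simp only [Complex.zero_re] at h
    simp only [Complex.sub_re, Complex.one_re]
    linarith
  · intro x hx y hy a b ha hb hab
    have hx' : -1 ≤ corrTrace (blochCoord x) := hx
    have hy' : -1 ≤ corrTrace (blochCoord y) := hy
    have h : corrTrace (blochCoord (a • x + b • y)) =
        a * corrTrace (blochCoord x) + b * corrTrace (blochCoord y) := by
      simp only [map_add, map_smul, corrTrace, Pi.add_apply, Pi.smul_apply, smul_eq_mul,
        Finset.sum_add_distrib, Finset.mul_sum]
    change -1 ≤ corrTrace (blochCoord (a • x + b • y))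
    rw [h]
    nlinarith

lemma blochCoord_one : blochCoord 1 = 0 := by
  ext (i | i | ⟨i, j⟩)
  · fin_cases i <;> simp [blochCoord, pauliProd, pauli, Matrix.trace_kronecker,
      Matrix.trace_fin_two]
  · fin_cases i <;> simp [blochCoord, pauliProd, pauli, Matrix.trace_kronecker,
      Matrix.trace_fin_two]
  · fin_cases i <;> fin_cases j <;> simp [blochCoord, pauliProd, pauli, Matrix.trace_kronecker,
      Matrix.trace_fin_two]

lemma not_isSeparable_blochMatrix {p : ℝ} (hp : 1 / 3 < p) :
    ¬ IsSeparable (blochMatrix (p • singletBloch)) := by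
  intro h
  have h1 := neg_one_le_corrTrace h
  have h2 : blochCoord (blochMatrix (p • singletBloch)) = p • singletBloch := by
    have : blochMatrix (p • singletBloch) = p • blochMatrix singletBloch +
        ((1 - p) / 4 : ℝ) • (1 : Matrix (Fin 2 × Fin 2) (Fin 2 × Fin 2) ℂ) := by
      rw [blochMatrix_smul]
      ext i j; simp
    rw [this, map_add, map_smul, map_smul, blochCoord_one, blochCoord_blochMatrix_singlet]
    simp
  rw [h2] at h1
  simp [corrTrace, singletBloch] at h1
  linarith

/-! ### Local unitaries and the choice of the initial vector -/

section LocalUnitary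

variable {m n : Type*} [Fintype m] [Fintype n] [DecidableEq m] [DecidableEq n]

lemma isState_conj {ρ V : Matrix n n ℂ} (hρ : IsState ρ) (hV : Vᴴ * V = 1) :
    IsState (V * ρ * Vᴴ) := by
  refine ⟨hρ.1.mul_mul_conjTranspose_same V, ?_⟩
  rw [Matrix.trace_mul_comm, ← mul_assoc, hV, one_mul, hρ.2]

lemma isSeparable_conj {ρ : Matrix (m × n) (m × n) ℂ} (hρ : IsSeparable ρ) {U : Matrix m m ℂ}
    (hU : Uᴴ * U = 1) : IsSeparable ((U ⊗ₖ (1 : Matrix n n ℂ)) * ρ * (U ⊗ₖ (1 : Matrix n n ℂ))ᴴ) := by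
  refine convexHull_min (t := {ρ | IsSeparable ((U ⊗ₖ (1 : Matrix n n ℂ)) * ρ *
    (U ⊗ₖ (1 : Matrix n n ℂ))ᴴ)}) ?_ ?_ hρ
  · rintro _ ⟨σ, τ, hσ, hτ, rfl⟩
    refine subset_convexHull ℝ _ ⟨U * σ * Uᴴ, τ, isState_conj hσ hU, hτ, ?_⟩
    rw [Matrix.conjTranspose_kronecker, ← Matrix.mul_kronecker_mul, ← Matrix.mul_kronecker_mul]
    simp
  · intro x hx y hy a b ha hb hab
    have := convex_convexHull ℝ (productStates m n) hx hy ha hb hab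
    change _ ∈ convexHull ℝ (productStates m n)
    convert this using 1
    simp [mul_add, add_mul]

end LocalUnitary

/-- The maximally entangled vector obtained from the singlet by a local operator. -/
def localVec (U : Matrix (Fin 2) (Fin 2) ℂ) : Fin 2 × Fin 2 → ℂ :=
  (U ⊗ₖ (1 : Matrix (Fin 2) (Fin 2) ℂ)) *ᵥ singletVec

lemma localVec_add (U W : Matrix (Fin 2) (Fin 2) ℂ) :
    localVec (U + W) = localVec U + localVec W := by
  rw [localVec, Matrix.add_kronecker, Matrix.add_mulVec]; rfl

lemma localVec_smul (c : ℂ) (U : Matrix (Fin 2) (Fin 2) ℂ) :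
    localVec (c • U) = c • localVec U := by
  rw [localVec, Matrix.smul_kronecker, Matrix.smul_mulVec]; rfl

/-- `localVec` is an isometry for the Hilbert–Schmidt product, so the identity and Pauli matrices
give an orthogonal basis. -/
lemma star_localVec_dotProduct (U W : Matrix (Fin 2) (Fin 2) ℂ) :
    star (localVec U) ⬝ᵥ localVec W = (Uᴴ * W).trace := by
  simp [localVec, singletVec, Matrix.mulVec, dotProduct, Fintype.sum_prod_type, Matrix.trace,
    Matrix.mul_apply, Matrix.kroneckerMap_apply]
  ring

lemma pauli_conjTranspose (k : Fin 3) : (pauli k)ᴴ = pauli k := by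
  ext i j; fin_cases k <;> fin_cases i <;> fin_cases j <;> simp [pauli]

lemma pauli_mul_self (k : Fin 3) : pauli k * pauli k = 1 := by
  ext i j; fin_cases k <;> fin_cases i <;> fin_cases j <;> simp [pauli]

lemma trace_pauli (k : Fin 3) : (pauli k).trace = 0 := by
  fin_cases k <;> simp [pauli, Matrix.trace_fin_two]

/-- Only scalar operators have all maximally entangled vectors as eigenvectors. -/
lemma exists_localVec_not_eigenvector {A : Matrix (Fin 2 × Fin 2) (Fin 2 × Fin 2) ℂ}
    (hA : ∀ c : ℂ, A ≠ c • (1 : Matrix (Fin 2 × Fin 2) (Fin 2 × Fin 2) ℂ)) :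
    ∃ U : Matrix (Fin 2) (Fin 2) ℂ, Uᴴ * U = 1 ∧
      ∀ μ : ℂ, A *ᵥ localVec U ≠ μ • localVec U := by
  by_contra! h
  obtain ⟨μ, hμ⟩ := h 1 (by simp)
  have hk : ∀ k, A *ᵥ localVec (pauli k) = μ • localVec (pauli k) := by
    intro k
    obtain ⟨ν, hν⟩ := h (pauli k) (by rw [pauli_conjTranspose, pauli_mul_self])
    -- Unitary because `pauli k` is Hermitian, the factor `I` cancels the cross terms, and 3, 4, 5
    -- is a Pythagorean triple. Pairing with the two orthogonal summands forces equal eigenvalues.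
    obtain ⟨κ, hκ⟩ := h ((3 / 5 : ℂ) • 1 + (4 / 5 * Complex.I : ℂ) • pauli k) (by
      simp only [Matrix.conjTranspose_add, Matrix.conjTranspose_smul, pauli_conjTranspose,
        Matrix.conjTranspose_one, add_mul, mul_add, smul_mul_smul_comm, pauli_mul_self, mul_one,
        one_mul]
      ext i j
      simp
      ring_nf
      rw [Complex.I_sq]; ring)
    rw [localVec_add, localVec_smul, localVec_smul, Matrix.mulVec_add, Matrix.mulVec_smul,
      Matrix.mulVec_smul, hμ, hν] at hκ
    have e1 := congrArg (star (localVec 1) ⬝ᵥ ·) hκ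
    have e2 := congrArg (star (localVec (pauli k)) ⬝ᵥ ·) hκ
    simp [dotProduct_add, dotProduct_smul, star_localVec_dotProduct, pauli_conjTranspose,
      pauli_mul_self, trace_pauli] at e1 e2
    have : ν = μ := by
      linear_combination (-5 / 8 * Complex.I) * e2 + (ν - κ) * Complex.I_sq - (5 / 6) * e1
    rw [hν, this]
  have hy : A *ᵥ localVec !![0, 1; -1, 0] = μ • localVec !![0, 1; -1, 0] := by
    have : !![0, 1; -1, 0] = Complex.I • pauli 1 := by
      ext i j; fin_cases i <;> fin_cases j <;> simp [pauli]
    rw [this, localVec_smul, Matrix.mulVec_smul, hk, smul_comm]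
  -- Half-sums and half-differences of these four eigenvectors are, up to sign, the standard basis.
  refine hA μ ?_
  ext ⟨p, p'⟩ ⟨q, q'⟩
  have g0 := congrFun hμ (p, p')
  have g1 := congrFun (hk 0) (p, p')
  have g2 := congrFun hy (p, p')
  have g3 := congrFun (hk 2) (p, p')
  fin_cases p <;> fin_cases p' <;>
    simp [localVec, singletVec, pauli, Matrix.mulVec, dotProduct, Fintype.sum_prod_type,
      Matrix.kroneckerMap_apply] at g0 g1 g2 g3 <;>
    fin_cases q <;> fin_cases q' <;> simp <;>
    first
    | linear_combination (-1 / 2 : ℂ) * g1 - (1 / 2 : ℂ) * g2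
    | linear_combination (1 / 2 : ℂ) * g1 - (1 / 2 : ℂ) * g2
    | linear_combination (1 / 2 : ℂ) * g0 + (1 / 2 : ℂ) * g3
    | linear_combination (-1 / 2 : ℂ) * g0 + (1 / 2 : ℂ) * g3

/-- The generator is traceless, so only the negative overlap rate with `localVec U` remains, with
factor `-2`. -/
lemma corrTrace_conj_lindbladian {N : ℕ} (H : Matrix (Fin 2 × Fin 2) (Fin 2 × Fin 2) ℂ)
    (A : Fin N → Matrix (Fin 2 × Fin 2) (Fin 2 × Fin 2) ℂ) {U : Matrix (Fin 2) (Fin 2) ℂ}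
    (hU : Uᴴ * U = 1) {i : Fin N} (hi : ∀ μ : ℂ, A i *ᵥ localVec U ≠ μ • localVec U)
    {V : Matrix (Fin 2 × Fin 2) (Fin 2 × Fin 2) ℂ}
    (hV : V = U ⊗ₖ (1 : Matrix (Fin 2) (Fin 2) ℂ)) (hVV : V * Vᴴ = 1) :
    0 < corrTrace (blochCoord
      (Vᴴ * lindbladian H A (V * blochMatrix singletBloch * Vᴴ) * V)) := by
  have hv : localVec U ≠ 0 := fun h => by
    have := star_localVec_dotProduct U U
    rw [h, hU] at this
    simp at this
  have hneg := re_dotProduct_lindbladian_neg H A hv hi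
  have hvec : V * blochMatrix singletBloch * Vᴴ =
      (1 / 2 : ℂ) • Matrix.vecMulVec (localVec U) (star (localVec U)) := by
    rw [blochMatrix_singletBloch, mul_smul_comm, smul_mul_assoc, localVec, ← hV,
      Matrix.mul_vecMulVec, Matrix.vecMulVec_mul, Matrix.star_mulVec]
  have hlin : lindbladian H A ((1 / 2 : ℂ) • Matrix.vecMulVec (localVec U) (star (localVec U))) =
      (1 / 2 : ℂ) • lindbladian H A (Matrix.vecMulVec (localVec U) (star (localVec U))) :=
    (lindbladianₗ H A).map_smul _ _
  have hdot : ∀ D : Matrix (Fin 2 × Fin 2) (Fin 2 × Fin 2) ℂ,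
      star singletVec ⬝ᵥ (Vᴴ * D * V) *ᵥ singletVec =
        star (localVec U) ⬝ᵥ D *ᵥ localVec U := fun D => by
    rw [localVec, ← hV, Matrix.star_mulVec, ← Matrix.mulVec_mulVec, ← Matrix.mulVec_mulVec,
      Matrix.dotProduct_mulVec]
  rw [corrTrace_blochCoord, hdot, Matrix.trace_mul_comm, ← mul_assoc, hVV, one_mul,
    trace_lindbladian, hvec, hlin, Matrix.smul_mulVec, dotProduct_smul]
  simp
  linarith

lemma isState_blochMatrix_smul_singletBloch {p : ℝ} (h0 : 0 ≤ p) (h1 : p ≤ 1) :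
    IsState (blochMatrix (p • singletBloch)) := by
  have h2 : (0 : ℂ) ≤ 1 / 2 := by positivity
  rw [blochMatrix_smul, blochMatrix_singletBloch]
  refine ⟨(((Matrix.posSemidef_vecMulVec_self_star _).smul h2).smul ?_).add
    (Matrix.PosSemidef.one.smul ?_), ?_⟩
  · exact_mod_cast h0
  · exact_mod_cast div_nonneg (sub_nonneg.2 h1) (by norm_num : (0 : ℝ) ≤ 4)
  · simp [Matrix.trace, Matrix.vecMulVec_apply, singletVec, Fintype.sum_prod_type]
    ring

lemma isEntangled_conj_blochMatrix {p : ℝ} (h0 : 1 / 3 < p) (h1 : p < 1)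
    {U : Matrix (Fin 2) (Fin 2) ℂ} (hU : Uᴴ * U = 1) :
    IsEntangled ((U ⊗ₖ (1 : Matrix (Fin 2) (Fin 2) ℂ)) * blochMatrix (p • singletBloch) *
      (U ⊗ₖ (1 : Matrix (Fin 2) (Fin 2) ℂ))ᴴ) := by
  have hV : (U ⊗ₖ (1 : Matrix (Fin 2) (Fin 2) ℂ))ᴴ * (U ⊗ₖ (1 : Matrix (Fin 2) (Fin 2) ℂ)) = 1 := by
    rw [Matrix.conjTranspose_kronecker, ← Matrix.mul_kronecker_mul, hU]; simp
  refine ⟨isState_conj (isState_blochMatrix_smul_singletBloch (by linarith) h1.le) hV,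
    fun h => not_isSeparable_blochMatrix h0 ?_⟩
  have := isSeparable_conj h (U := Uᴴ) (by
    rw [Matrix.conjTranspose_conjTranspose, mul_eq_one_comm]; exact hU)
  have hV' : Uᴴ ⊗ₖ (1 : Matrix (Fin 2) (Fin 2) ℂ) = (U ⊗ₖ (1 : Matrix (Fin 2) (Fin 2) ℂ))ᴴ := by
    rw [Matrix.conjTranspose_kronecker]; simp
  rw [hV', Matrix.conjTranspose_conjTranspose] at this
  convert this using 1
  simp only [mul_assoc, hV, mul_one]
  rw [← mul_assoc, hV, one_mul]

/-- Conjugation by a fixed matrix, as a real-linear map. -/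
def conjₗ {n : Type*} [Fintype n] (V : Matrix n n ℂ) : Matrix n n ℂ →ₗ[ℝ] Matrix n n ℂ where
  toFun M := Vᴴ * M * V
  map_add' M M' := by rw [mul_add, add_mul]
  map_smul' c M := by simp

end QDyn

/-! ### Assembly -/

theorem mainTheorem4 {N : ℕ}
    (H : Matrix (Fin 2 × Fin 2) (Fin 2 × Fin 2) ℂ) (hH : H.IsHermitian)
    (A : Fin N → Matrix (Fin 2 × Fin 2) (Fin 2 × Fin 2) ℂ)
    (hA : ∃ i, ∀ c : ℂ, A i ≠ c • (1 : Matrix (Fin 2 × Fin 2) (Fin 2 × Fin 2) ℂ))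
    (hunital : ∑ i, (A i * (A i).conjTranspose - (A i).conjTranspose * A i) = 0)
    (Λ : ℝ → Matrix (Fin 2 × Fin 2) (Fin 2 × Fin 2) ℂ →ₗ[ℂ]
      Matrix (Fin 2 × Fin 2) (Fin 2 × Fin 2) ℂ)
    (hΛ : QDyn.IsLindbladDynamics H A Λ) :
    (∀ t : ℝ, 0 ≤ t → Λ t 1 = 1) ∧ QDyn.HasFTD Λ := by
  have hone : ∀ t : ℝ, 0 ≤ t → Λ t 1 = 1 := fun t ht => QDyn.dynamics_one hΛ hunital ht
  refine ⟨hone, ?_⟩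
  obtain ⟨i, hi⟩ := hA
  obtain ⟨U, hU, hUi⟩ := QDyn.exists_localVec_not_eigenvector hi
  obtain ⟨V, hV⟩ : ∃ V, V = U ⊗ₖ (1 : Matrix (Fin 2) (Fin 2) ℂ) := ⟨_, rfl⟩
  have hVV : Vᴴ * V = 1 := by
    rw [hV, Matrix.conjTranspose_kronecker, ← Matrix.mul_kronecker_mul, hU]; simp
  have hVV' : V * Vᴴ = 1 := mul_eq_one_comm.1 hVV
  set ρ := V * QDyn.blochMatrix QDyn.singletBloch * Vᴴ with hρ
  have hst : QDyn.IsState ρ := by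
    have := QDyn.isState_blochMatrix_smul_singletBloch zero_le_one le_rfl
    rw [one_smul] at this
    exact QDyn.isState_conj this hVV
  -- The evolution in the rotated frame, where it starts at the singlet.
  set Y : ℝ → Matrix (Fin 2 × Fin 2) (Fin 2 × Fin 2) ℂ := fun t => Vᴴ * Λ t ρ * V with hY
  have hYherm : ∀ t, 0 ≤ t → (Y t).IsHermitian := fun t ht =>
    Matrix.isHermitian_conjTranspose_mul_mul V (QDyn.isHermitian_dynamics hH hΛ hst ht)
  have hYtr : ∀ t, 0 ≤ t → (Y t).trace = 1 := fun t ht => by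
    rw [hY, Matrix.trace_mul_comm, ← mul_assoc, hVV', one_mul, QDyn.trace_dynamics hΛ hst ht]
  have hder : ∀ t, 0 ≤ t → HasDerivWithinAt (fun t => QDyn.blochCoord (Y t))
      (QDyn.blochCoord (Vᴴ * QDyn.lindbladian H A (Λ t ρ) * V)) (Set.Ici 0) t := fun t ht =>
    QDyn.hasDerivWithinAt_linear QDyn.blochCoord
      (QDyn.hasDerivWithinAt_linear' (QDyn.conjₗ V) ((hΛ ρ hst).2 t ht))
  have hd0 := hder 0 le_rfl
  rw [(hΛ ρ hst).1] at hd0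
  have hY0 : Y 0 = QDyn.blochMatrix QDyn.singletBloch := by
    simp only [hY, (hΛ ρ hst).1]
    simp only [hρ, mul_assoc, hVV, mul_one]
    rw [← mul_assoc, hVV, one_mul]
  obtain ⟨p, hp0, hp1, a, b, ha, hab, hsep⟩ := QDyn.exists_smul_mem_blochSep
    (x := fun t => QDyn.blochCoord (Y t))
    (by simp only [hY0, QDyn.blochCoord_blochMatrix_singlet])
    (fun t ht => (hder t ht).continuousWithinAt) hd0
    (QDyn.corrTrace_conj_lindbladian H A hU hUi hV hVV')
  refine ⟨_, QDyn.isEntangled_conj_blochMatrix hp0 hp1 hU, a, b, ha, by exact_mod_cast hab,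
    fun t hat htb => ?_⟩
  have ht : 0 ≤ t := (ha.trans hat).le
  have hs := QDyn.isSeparable_conj
    (QDyn.isSeparable_blochMatrix (hsep t hat (by exact_mod_cast htb))) hU
  rw [QDyn.blochMatrix_smul, QDyn.blochMatrix_blochCoord (hYherm t ht) (hYtr t ht), ← hV] at hs
  convert hs using 1
  rw [QDyn.blochMatrix_smul, ← hV]
  -- Unitality enters here: the noise term is fixed by `Λ t`.
  simp only [mul_add, add_mul, mul_smul_comm, smul_mul_assoc, mul_one, hVV', map_add, map_smul,
    hone t ht, hY, ← hρ]
  congr 2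
  simp only [mul_assoc, hVV', mul_one]
  rw [← mul_assoc, hVV', one_mul]
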